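/- Let $(\epsilon_k)_{k\ge 0}$ be a strictly decreasing sequence of positive reals with $\epsilon_k\to 0$ and $\epsilon_0<1$; put $\epsilon_{-1}=1$ and assume $$\frac{\epsilon_{k-1}-\epsilon_k}{\epsilon_{k-2}-\epsilon_{k-1}}<1\qquad\text{for all } k\ge 1 .$$ Let $L:[0,1]\to[0,1]$ be the piecewise linear map given by $L(0)=0$, by $$L(x)=\frac{\epsilon_{k-2}-\epsilon_{k-1}}{\epsilon_{k-1}-\epsilon_k}\,(x-\epsilon_k)+\epsilon_{k-1}\qquad\text{for } \epsilon_k<x\le\epsilon_{k-1},\ k\ge 1,$$ and by $L(x)=\frac{x-\epsilon_0}{1-\epsilon_0}$ for $\epsilon_0<x\le 1$. Let $Z=\{I_0,I_1\}$ with $I_0=[0,\epsilon_0]$ and $I_1=(\epsilon_0,1]$. For $x\in[0,1]$ let $\omega=\omega(x)\in\{0,1\}^{\mathbb N}$ be its symbolic orbit, that is, $L^i(x)\in I_{\omega_i}$ for all $i\ge 0$, and let $$N_n(x)=\#\{\,0\le i\le n-1 : L^i(x)\in I_1\,\}.$$ Call a partial recursive function $C$ from finite binary strings to finite binary strings a universal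 machine if for every partial recursive function $D$ from finite binary strings to finite binary strings there is a binary string $p_D$ such that $D(q)=C(p_Dq)$ for all binary strings $q$ (where both sides may be undefined). Fix a universal machine $C$, and let $AIC(s)=\min\{|p| : C(p)=s\}$ for a binary string $s$, and $AIC(x,n,Z)=AIC(\omega_0\omega_1\cdots\omega_{n-1})$. Let $F(x)=\sum_{k=1}^{\lfloor x\rfloor}(\epsilon_{k-2}-\epsilon_{k-1})$, and suppose that there are real constants $A$ and $\alpha>0$ such that $$F(x)=1-A\,x^{-\alpha}+o(x^{-\alpha})\qquad\text{as } x\to\infty .$$ Then, with $\mathbb E_m$ denoting the mean with respect to Lebesgue measure $m$ on $[0,1]$, as $n\to\infty$, $$\mathbb E_m[N_n]=O\big(\mathbb E_m[AIC(x,n,Z)]\big)\qquad\text{and}\qquad \mathbb E_m[AIC(x,n,Z)]=O\big(\mathbb E_m[N_n]\,\log n\big).$$ -/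

import Mathlib

open Filter Topology Asymptotics MeasureTheory

noncomputable section

/-! ### Algorithmic information content -/

/-- A (plain) universal computing machine: a partial recursive function `C` from binary programs
to binary strings such that for every other machine `D` there is a program `p` with
`D q = C (p q)` for all `q` (both sides undefined, or both defined and equal). -/
def IsUniversalMachine (C : List Bool →. List Bool) : Prop :=
  Partrec C ∧
    ∀ D : List Bool →. List Bool, Partrec D → ∃ p : List Bool, ∀ q : List Bool, D q = C (p ++ q)

/-- `AIC(s, C) = min {|p| : C(p) = s}`. The set is nonempty if `C` is universal. -/
def aic (C : List Bool →. List Bool) (s : List Bool) : ℕ :=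
  sInf {l : ℕ | ∃ p : List Bool, p.length = l ∧ s ∈ C p}

/-! ### Symbolic orbits for a partition `Z = {I₀, I₁}` -/

open Classical in
/-- The symbolic orbit of `x` under `T` for the partition `{I₀, I₁}`, where `I₀` is the complement
of `I₁`; the symbol `1` is `true` and the symbol `0` is `false`. -/
def symbolicOrbit {X : Type*} (T : X → X) (I₁ : Set X) (x : X) (i : ℕ) : Bool :=
  decide (T^[i] x ∈ I₁)

/-- The string `ω^n = (ω_0, …, ω_{n-1})`. -/
def initialWord (ω : ℕ → Bool) (n : ℕ) : List Bool :=
  (List.range n).map ω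

/-- `N_n(ω) = #{i | ω_i ≠ 0, i = 0, …, n-1}`. -/
def visits (ω : ℕ → Bool) (n : ℕ) : ℕ :=
  ((Finset.range n).filter fun i => ω i ≠ false).card

/-! ### Piecewise linear maps -/

/-- The sequence `ε` preceded by `ε_{-1} = 1`: the value at `j` is `ε_{j-1}`. -/
def epsShift (ε : ℕ → ℝ) : ℕ → ℝ
  | 0 => 1
  | k + 1 => ε k

/-- The sequences that define the piecewise linear maps: positive, strictly decreasing (also from
`ε_{-1} = 1` to `ε_0`), tending to `0`, with
`(ε_{k-1} - ε_k) / (ε_{k-2} - ε_{k-1}) < 1` for all `k ≥ 1`. -/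
structure IsPLSequence (ε : ℕ → ℝ) : Prop where
  pos : ∀ k, 0 < ε k
  strictAnti : StrictAnti ε
  zero_lt_one : ε 0 < 1
  tendsto_zero : Tendsto ε atTop (𝓝 0)
  ratio_lt_one : ∀ k : ℕ,
    (epsShift ε (k + 1) - epsShift ε (k + 2)) / (epsShift ε k - epsShift ε (k + 1)) < 1

/-- The piecewise linear map `L` of the sequence `ε` (meant on `[0, 1]`). For `x > 0` the number
`sInf {k | ε k < x}` is the least `k` with `ε_k < x`, that is, the `k` with
`ε_k < x ≤ ε_{k-1}`; see `plMap_of_mem` and `plMap_of_lt` for the resulting formulas. -/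
def plMap (ε : ℕ → ℝ) (x : ℝ) : ℝ :=
  if x ≤ 0 then 0 else
    match sInf {k : ℕ | ε k < x} with
    | 0 => (x - ε 0) / (1 - ε 0)
    | k + 1 => (epsShift ε k - ε k) / (ε k - ε (k + 1)) * (x - ε (k + 1)) + ε k

theorem plMap_zero (ε : ℕ → ℝ) : plMap ε 0 = 0 := by simp [plMap]

theorem plMap_of_lt {ε : ℕ → ℝ} (hε : IsPLSequence ε) {x : ℝ} (hx : ε 0 < x) :
    plMap ε x = (x - ε 0) / (1 - ε 0) := by
  have h0 : ¬ x ≤ 0 := not_le.2 ((hε.pos 0).trans hx)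
  have h : sInf {k : ℕ | ε k < x} = 0 := Nat.sInf_eq_zero.2 (Or.inl hx)
  simp only [plMap, h0, if_false, h]

theorem plMap_of_mem {ε : ℕ → ℝ} (hε : IsPLSequence ε) {x : ℝ} {k : ℕ}
    (h1 : ε (k + 1) < x) (h2 : x ≤ ε k) :
    plMap ε x = (epsShift ε k - ε k) / (ε k - ε (k + 1)) * (x - ε (k + 1)) + ε k := by
  have h0 : ¬ x ≤ 0 := not_le.2 ((hε.pos _).trans h1)
  have h : sInf {k : ℕ | ε k < x} = k + 1 := by
    apply le_antisymm (Nat.sInf_le h1)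
    refine le_csInf (s := {k : ℕ | ε k < x}) ⟨k + 1, h1⟩ ?_
    intro j hj
    by_contra hjk
    exact absurd (hε.strictAnti.antitone (show j ≤ k by omega)) (not_le.2 (lt_of_lt_of_le hj h2))
  simp only [plMap, h0, if_false, h]

theorem plMap_mapsTo {ε : ℕ → ℝ} (hε : IsPLSequence ε) :
    Set.MapsTo (plMap ε) (Set.Icc 0 1) (Set.Icc 0 1) := by
  rintro x ⟨h0, h1⟩
  rcases h0.eq_or_lt with rfl | h0
  · simp [plMap]
  by_cases h : ε 0 < x
  · rw [plMap_of_lt hε h]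
    have := hε.zero_lt_one
    exact ⟨div_nonneg (by linarith) (by linarith), (div_le_one (by linarith)).2 (by linarith)⟩
  · have hex : ∃ k, ε k < x := ((hε.tendsto_zero.eventually (gt_mem_nhds h0)).exists)
    classical
    obtain ⟨k, hk⟩ : ∃ k, Nat.find hex = k + 1 := Nat.exists_eq_succ_of_ne_zero (by
      intro h'; exact h ((Nat.find_eq_zero hex).1 h'))
    have h1 : ε (k+1) < x := hk ▸ Nat.find_spec hex
    have h2 : x ≤ ε k := not_lt.1 (Nat.find_min hex (by omega))
    rw [plMap_of_mem hε h1 h2]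
    have a : ε (k+1) < ε k := hε.strictAnti (by omega)
    have b : ε k < epsShift ε k ∧ epsShift ε k ≤ 1 := by
      cases k with
      | zero => simp [epsShift, hε.zero_lt_one]
      | succ j => exact ⟨hε.strictAnti (by omega),
          (hε.strictAnti.antitone (Nat.zero_le j)).trans hε.zero_lt_one.le⟩
    have c := hε.pos k
    have d : (epsShift ε k - ε k) / (ε k - ε (k + 1)) * (x - ε (k + 1)) ≤ epsShift ε k - ε k := by
      rw [div_mul_eq_mul_div, div_le_iff₀ (by linarith)]
      exact mul_le_mul_of_nonneg_left (by linarith) (by linarith)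
    have e : 0 ≤ (epsShift ε k - ε k) / (ε k - ε (k + 1)) * (x - ε (k + 1)) :=
      mul_nonneg (div_nonneg (by linarith) (by linarith)) (by linarith)
    exact ⟨by linarith, by linarith⟩

/-- The interval `I₁ = (ε_0, 1]` of the partition `Z = {[0, ε_0], (ε_0, 1]}` of `[0, 1]`. -/
def plI₁ (ε : ℕ → ℝ) : Set ℝ := Set.Ioc (ε 0) 1

/-- `F(x) = ∑_{k=1}^{⌊x⌋} (ε_{k-2} - ε_{k-1})`, the distribution function of the time of first
passage through `I₁` under Lebesgue measure. -/
def plDistr (ε : ℕ → ℝ) (x : ℝ) : ℝ :=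
  ∑ k ∈ Finset.range ⌊x⌋₊, (epsShift ε k - epsShift ε (k + 1))

/-- `E_m[N_n]` for the Lebesgue measure `m` on `[0, 1]`. -/
def expectedVisits (ε : ℕ → ℝ) (n : ℕ) : ℝ :=
  ∫ x in Set.Icc (0 : ℝ) 1, (visits (symbolicOrbit (plMap ε) (plI₁ ε) x) n : ℝ)

/-- `E_m[AIC(x, n, Z)]` for the Lebesgue measure `m` on `[0, 1]`. -/
def expectedAIC (C : List Bool →. List Bool) (ε : ℕ → ℝ) (n : ℕ) : ℝ :=
  ∫ x in Set.Icc (0 : ℝ) 1,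
    (aic C (initialWord (symbolicOrbit (plMap ε) (plI₁ ε) x) n) : ℝ)

end

open scoped ENNReal

/-! ### Initial words and visits -/

/-! Put ρ = max(1 - ε_0, ε_0) < 1 and let N(w) be the number of ones in a word w. For the first
relation, L maps each piece (ε_{k+1}, ε_k] affinely onto the preceding one, and I₁ affinely onto (0,
1]. Each further visit to I₁ forces the orbit into a prescribed piece of length at most ρ, so the
cylinder of w has measure at most ρ^N(w) (`volume_Ioc_inter_plCylinder_le`). Distinct words have
distinct shortest programs, whence ∑ 4^(-AIC(w)) ≤ 2. Together these give ∫ ρ^(-N) 4^(-AIC) dm ≤ 2,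
and log t ≤ t turns this into a linear inequality between the two means
(`expectedVisits_le_expectedAIC`). Its additive constant is absorbed because E[AIC] is bounded below
for n ≥ 1 (`one_sub_max_le_expectedAIC`). For the second relation, a word is recovered from the
lengths of its N + 1 runs of zeros, each written with O(log n) bits (`exists_gapDecode_eq`). The
extra 1 is absorbed because E[N_n] ≥ 1 - ε_0 for n ≥ 1. -/

theorem initialWord_succ (ω : ℕ → Bool) (n : ℕ) :
    initialWord ω (n + 1) = ω 0 :: initialWord (fun i => ω (i + 1)) n := by
  simp [initialWord, List.range_succ_eq_map, Function.comp_def]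

theorem length_initialWord (ω : ℕ → Bool) (n : ℕ) : (initialWord ω n).length = n := by
  simp [initialWord]

theorem visits_eq_count (ω : ℕ → Bool) (n : ℕ) : visits ω n = (initialWord ω n).count true := by
  induction n with
  | zero => simp [visits, initialWord]
  | succ n ih =>
    have h1 : initialWord ω (n + 1) = initialWord ω n ++ [ω n] := by
      simp [initialWord, List.range_succ]
    rw [h1, List.count_append, ← ih, visits, visits, Finset.range_add_one, Finset.filter_insert]
    cases h : ω n <;> simp

/-- The initial word of length `n` of the symbolic orbit of `x` under the piecewise linear map. -/
noncomputable def plWord (ε : ℕ → ℝ) (n : ℕ) (x : ℝ) : List Bool :=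
  initialWord (symbolicOrbit (plMap ε) (plI₁ ε) x) n

theorem length_plWord (ε : ℕ → ℝ) (n : ℕ) (x : ℝ) : (plWord ε n x).length = n :=
  length_initialWord _ _

open Classical in
theorem plWord_succ (ε : ℕ → ℝ) (n : ℕ) (x : ℝ) :
    plWord ε (n + 1) x = decide (x ∈ plI₁ ε) :: plWord ε n (plMap ε x) := by
  rw [plWord, initialWord_succ]; rfl

/-! ### A machine that decodes gap lengths -/

/-- One step of the decoder. The state consists of a phase bit, the pending first bit of a pair,
a counter, and the output. The pair `0b` sends the counter `c` to `2c + b`; the pair `1b` moves `c`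
zeros, followed by a one if `b = 1`, to the output. -/
def gapStep (s : Bool × Bool × ℕ × List Bool) (b : Bool) : Bool × Bool × ℕ × List Bool :=
  cond s.1
    (cond s.2.1
      (false, false, 0,
        (s.2.2.2 ++ (List.range s.2.2.1).map fun _ => false) ++ cond b [true] [])
      (false, false, cond b (2 * s.2.2.1 + 1) (2 * s.2.2.1), s.2.2.2))
    (true, b, s.2.2.1, s.2.2.2)

/-- The decoder: the output after all bits have been read. -/
def gapDecode (q : List Bool) : List Bool :=
  (q.foldl gapStep (false, false, 0, [])).2.2.2

theorem primrec₂_gapStep : Primrec₂ gapStep := by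
  have hs : Primrec fun p : (Bool × Bool × ℕ × List Bool) × Bool => p.1 := Primrec.fst
  have hb : Primrec fun p : (Bool × Bool × ℕ × List Bool) × Bool => p.2 := Primrec.snd
  have h1 := Primrec.fst.comp hs
  have h2 := Primrec.fst.comp (Primrec.snd.comp hs)
  have h3 := Primrec.fst.comp (Primrec.snd.comp (Primrec.snd.comp hs))
  have h4 := Primrec.snd.comp (Primrec.snd.comp (Primrec.snd.comp hs))
  have hd := Primrec.nat_mul.comp (Primrec.const 2) h3
  refine Primrec.cond h1 (Primrec.cond h2 ?_ ?_) ?_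
  · refine (Primrec.const false).pair ((Primrec.const false).pair ((Primrec.const 0).pair ?_))
    refine Primrec.list_append.comp (Primrec.list_append.comp h4 ?_)
      (Primrec.cond hb (Primrec.const _) (Primrec.const _))
    exact Primrec.list_map (Primrec.list_range.comp h3) (Primrec.const false).to₂
  · exact (Primrec.const false).pair ((Primrec.const false).pair
      ((Primrec.cond hb (Primrec.succ.comp hd) hd).pair h4))
  · exact (Primrec.const true).pair (hb.pair (h3.pair h4))

theorem computable_gapDecode : Computable gapDecode := by
  have h : Primrec fun q : List Bool => q.foldl gapStep (false, false, 0, []) :=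
    Primrec.list_foldl Primrec.id (Primrec.const _)
      (primrec₂_gapStep.comp (Primrec.fst.comp Primrec.snd) (Primrec.snd.comp Primrec.snd)).to₂
  exact (Primrec.snd.comp (Primrec.snd.comp (Primrec.snd.comp h))).to_comp

/-- The program is the binary expansion of `k`, most significant digit first, padded with leading
zeros to width `b`; every digit costs one pair. -/
theorem exists_foldl_gapStep_counter (b k : ℕ) (hk : k < 2 ^ b) :
    ∃ q : List Bool, q.length = 2 * b ∧ ∀ out,
      q.foldl gapStep (false, false, 0, out) = (false, false, k, out) := by
  induction b generalizing k with
  | zero => exact ⟨[], rfl, fun out => by simp at hk; simp [hk]⟩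
  | succ b ih =>
    obtain ⟨q, hq, hrun⟩ := ih (k / 2) (by rw [pow_succ] at hk; omega)
    refine ⟨q ++ [false, decide (k % 2 = 1)], by simp [hq]; ring, fun out => ?_⟩
    rw [List.foldl_append, hrun]
    rcases Nat.mod_two_eq_zero_or_one k with h | h <;> simp [gapStep, h] <;> omega

/-- Here `k` counts the zeros read but not yet written. A zero of `w` moves into `k`, which keeps `k
+ w.length` fixed in the induction. Each one, and the end of the word, costs a block of `b` digit
pairs and one output pair. -/
theorem exists_foldl_gapStep_word (b : ℕ) (w : List Bool) (k : ℕ) (hk : k + w.length < 2 ^ b) :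
    ∃ q : List Bool, q.length ≤ (w.count true + 1) * (2 * b + 2) ∧ ∀ out,
      q.foldl gapStep (false, false, 0, out)
        = (false, false, 0, out ++ List.replicate k false ++ w) := by
  induction w generalizing k with
  | nil =>
    obtain ⟨q, hq, hrun⟩ := exists_foldl_gapStep_counter b k (by simpa using hk)
    refine ⟨q ++ [true, false], by simp [hq], fun out => ?_⟩
    rw [List.foldl_append, hrun]
    simp [gapStep]
  | cons c w ih =>
    cases c with
    | false =>
      obtain ⟨q, hq, hrun⟩ := ih (k + 1) (by simp at hk; omega)
      refine ⟨q, by simpa using hq, fun out => ?_⟩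
      rw [hrun]
      simp [List.replicate_succ']
    | true =>
      obtain ⟨q₁, hq₁, hrun₁⟩ := exists_foldl_gapStep_counter b k (by simp at hk; omega)
      obtain ⟨q, hq, hrun⟩ := ih 0 (by simp at hk; omega)
      refine ⟨q₁ ++ [true, true] ++ q, ?_, fun out => ?_⟩
      · simp [hq₁]; nlinarith
      · rw [List.foldl_append, List.foldl_append, hrun₁]
        simp [gapStep, hrun]

theorem exists_gapDecode_eq (b : ℕ) (w : List Bool) (hw : w.length < 2 ^ b) :
    ∃ q : List Bool, q.length ≤ (w.count true + 1) * (2 * b + 2) ∧ gapDecode q = w := by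
  obtain ⟨q, hq, hrun⟩ := exists_foldl_gapStep_word b w 0 (by simpa using hw)
  exact ⟨q, hq, by simp [gapDecode, hrun]⟩

/-! ### Elementary properties of the algorithmic information content -/

theorem IsUniversalMachine.exists_program {C : List Bool →. List Bool} (hC : IsUniversalMachine C)
    (s : List Bool) : ∃ p : List Bool, p.length = aic C s ∧ s ∈ C p := by
  -- Simulating the identity machine shows that `s` has some program, so `sInf` is attained and is
  -- not the default value `0`.
  obtain ⟨p, hp⟩ := hC.2 (fun q => Part.some q) Partrec.some
  exact Nat.sInf_mem (s := {l : ℕ | ∃ p : List Bool, p.length = l ∧ s ∈ C p})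
    ⟨_, p ++ s, rfl, by rw [← hp]; simp⟩

theorem aic_le {C : List Bool →. List Bool} {s p : List Bool} (h : s ∈ C p) :
    aic C s ≤ p.length :=
  Nat.sInf_le ⟨p, rfl, h⟩

/-- The constant is the length of the prefix that simulates `gapDecode`. It does not depend on `b`,
since the decoder accepts digits of any width. -/
theorem IsUniversalMachine.exists_aic_le_gaps {C : List Bool →. List Bool}
    (hC : IsUniversalMachine C) :
    ∃ c : ℕ, ∀ (b : ℕ) (w : List Bool), w.length < 2 ^ b →
      aic C w ≤ c + (w.count true + 1) * (2 * b + 2) := by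
  obtain ⟨p, hp⟩ := hC.2 (fun q => Part.some (gapDecode q)) computable_gapDecode.partrec
  refine ⟨p.length, fun b w hw => ?_⟩
  obtain ⟨q, hq, hrun⟩ := exists_gapDecode_eq b w hw
  have h := aic_le (C := C) (s := w) (p := p ++ q) (by rw [← hp]; simp [hrun])
  rw [List.length_append] at h
  omega

theorem IsUniversalMachine.exists_injective_program {C : List Bool →. List Bool}
    (hC : IsUniversalMachine C) :
    ∃ f : List Bool → List Bool, Function.Injective f ∧ ∀ s, (f s).length = aic C s := by
  choose f hf hfC using hC.exists_program
  refine ⟨f, fun s t hst => ?_, hf⟩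
  have h := hfC t
  rw [← hst] at h
  exact Part.mem_unique (hfC s) h

/-- Kraft's inequality for the lengths `2 |p| + 1`. -/
theorem tsum_four_inv_pow_length : ∑' p : List Bool, (4⁻¹ : ℝ≥0∞) ^ p.length = 2 := by
  have h4 : (4 : ℝ≥0∞)⁻¹ = 2⁻¹ * 2⁻¹ := by
    rw [← ENNReal.mul_inv (by simp) (by simp)]; norm_num
  rw [← (Equiv.sigmaFiberEquiv (List.length : List Bool → ℕ)).tsum_eq, ENNReal.tsum_sigma',
    ← ENNReal.tsum_geometric_two]
  refine tsum_congr fun n => ?_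
  have h : ∀ p : {l : List Bool // l.length = n}, (4⁻¹ : ℝ≥0∞) ^
      ((Equiv.sigmaFiberEquiv (List.length : List Bool → ℕ)) ⟨n, p⟩).length = 4⁻¹ ^ n := by
    rintro ⟨p, rfl⟩; rfl
  rw [tsum_congr h]
  change ∑' _ : List.Vector Bool n, (4⁻¹ : ℝ≥0∞) ^ n = _
  rw [tsum_fintype, Finset.sum_const, Finset.card_univ, card_vector, nsmul_eq_mul, h4, mul_pow,
    ← mul_assoc, Fintype.card_bool, Nat.cast_pow, ← mul_pow, Nat.cast_ofNat,
    ENNReal.mul_inv_cancel (by simp) (by simp), one_pow, one_mul]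

/-- Programs need not be prefix-free, and 2^(-|p|) is not summable over all strings. The base 4
restores convergence and costs only a constant factor in the final bound. -/
theorem IsUniversalMachine.tsum_four_inv_pow_aic_le {C : List Bool →. List Bool}
    (hC : IsUniversalMachine C) : ∑' s : List Bool, (4⁻¹ : ℝ≥0∞) ^ aic C s ≤ 2 := by
  obtain ⟨f, hf, hlen⟩ := hC.exists_injective_program
  rw [← tsum_four_inv_pow_length]
  simp_rw [← hlen]
  exact ENNReal.tsum_comp_le_tsum_of_injective hf fun p : List Bool => (4⁻¹ : ℝ≥0∞) ^ p.length

/-! ### Lebesgue measure of the cylinders of the piecewise linear map -/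

/-- The interval `(ε_k, ε_{k-1}]`, with `ε_{-1} = 1`: its points enter `I₁` for the first time at
time `k`. -/
def plPiece (ε : ℕ → ℝ) (k : ℕ) : Set ℝ := Set.Ioc (epsShift ε (k + 1)) (epsShift ε k)

theorem volume_plPiece (ε : ℕ → ℝ) (k : ℕ) :
    volume (plPiece ε k) = ENNReal.ofReal (epsShift ε k - epsShift ε (k + 1)) := by
  simp [plPiece]

theorem plPiece_zero (ε : ℕ → ℝ) : plPiece ε 0 = plI₁ ε := rfl

theorem volume_preimage_affine {a : ℝ} (ha : 0 < a) (b : ℝ) (s : Set ℝ) :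
    volume ((fun x => a * x + b) ⁻¹' s) = ENNReal.ofReal a⁻¹ * volume s := by
  have h : (fun x => a * x + b) ⁻¹' s = (a * ·) ⁻¹' ((· + b) ⁻¹' s) := rfl
  rw [h, Real.volume_preimage_mul_left ha.ne', measure_preimage_add_right,
    abs_of_pos (inv_pos.2 ha)]

/-- The points whose symbolic orbit starts with `w`. -/
def plCylinder (ε : ℕ → ℝ) (w : List Bool) : Set ℝ := {x | plWord ε w.length x = w}

open Classical in
theorem mem_plCylinder_cons {ε : ℕ → ℝ} {c : Bool} {w : List Bool} {x : ℝ} :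
    x ∈ plCylinder ε (c :: w) ↔ decide (x ∈ plI₁ ε) = c ∧ plMap ε x ∈ plCylinder ε w := by
  simp [plCylinder, plWord_succ]

namespace IsPLSequence

theorem epsShift_succ_lt {ε : ℕ → ℝ} (hε : IsPLSequence ε) (k : ℕ) :
    epsShift ε (k + 1) < epsShift ε k := by
  cases k with
  | zero => exact hε.zero_lt_one
  | succ k => exact hε.strictAnti k.lt_succ_self

theorem epsShift_pos {ε : ℕ → ℝ} (hε : IsPLSequence ε) (k : ℕ) : 0 < epsShift ε k := by
  cases k with
  | zero => exact one_pos
  | succ k => exact hε.pos k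

theorem epsShift_antitone {ε : ℕ → ℝ} (hε : IsPLSequence ε) : Antitone (epsShift ε) :=
  antitone_nat_of_succ_le fun k => (hε.epsShift_succ_lt k).le

theorem exists_mem_plPiece {ε : ℕ → ℝ} (hε : IsPLSequence ε) {x : ℝ} (h0 : 0 < x) (h1 : x ≤ 1) :
    ∃ k, x ∈ plPiece ε k := by
  classical
  have hex : ∃ k, ε k < x := (hε.tendsto_zero.eventually (gt_mem_nhds h0)).exists
  refine ⟨Nat.find hex, Nat.find_spec hex, ?_⟩
  rcases h : Nat.find hex with _ | k
  · exact h1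
  · exact not_lt.1 (Nat.find_min hex (by omega))

theorem plPiece_succ_notMem {ε : ℕ → ℝ} (hε : IsPLSequence ε) {k : ℕ} {x : ℝ}
    (hx : x ∈ plPiece ε (k + 1)) : x ∉ plI₁ ε := fun h =>
  absurd h.1 (not_lt.2 (hx.2.trans (hε.epsShift_antitone (show 1 ≤ k + 1 by omega))))

theorem plMap_mem_plPiece {ε : ℕ → ℝ} (hε : IsPLSequence ε) {k : ℕ} {x : ℝ}
    (hx : x ∈ plPiece ε (k + 1)) : plMap ε x ∈ plPiece ε k := by
  have h1 : 0 < ε k - ε (k + 1) := sub_pos.2 (hε.strictAnti k.lt_succ_self)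
  have h2 : 0 < epsShift ε k - ε k := sub_pos.2 (hε.epsShift_succ_lt k)
  have h3 : ε (k + 1) < x := hx.1
  have h4 : x ≤ ε k := hx.2
  rw [plMap_of_mem hε h3 h4]
  have h5 : 0 < (epsShift ε k - ε k) / (ε k - ε (k + 1)) * (x - ε (k + 1)) :=
    mul_pos (div_pos h2 h1) (by linarith)
  have h6 : (epsShift ε k - ε k) / (ε k - ε (k + 1)) * (x - ε (k + 1)) ≤ epsShift ε k - ε k := by
    rw [div_mul_eq_mul_div, div_le_iff₀ h1]
    exact mul_le_mul_of_nonneg_left (by linarith) h2.le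
  exact ⟨by change ε k < _; linarith, by linarith⟩

theorem plMap_mem_Ioc {ε : ℕ → ℝ} (hε : IsPLSequence ε) {x : ℝ} (hx : x ∈ plI₁ ε) :
    plMap ε x ∈ Set.Ioc (0 : ℝ) 1 := by
  have h := hε.zero_lt_one
  rw [plMap_of_lt hε hx.1]
  exact ⟨div_pos (by linarith [hx.1]) (by linarith),
    (div_le_one (by linarith)).2 (by linarith [hx.2])⟩

/-- The branch on this piece is affine, so measures scale by the ratio of the lengths of the pieces.
Only one inclusion is needed, and `E` may be arbitrary because the scaling formula holds for outer
measure. -/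
theorem volume_plPiece_succ_inter_le {ε : ℕ → ℝ} (hε : IsPLSequence ε) (k : ℕ) (E : Set ℝ) :
    volume (plPiece ε (k + 1) ∩ plMap ε ⁻¹' E) ≤
      ENNReal.ofReal ((ε k - ε (k + 1)) / (epsShift ε k - ε k)) * volume (plPiece ε k ∩ E) := by
  have h1 : 0 < ε k - ε (k + 1) := sub_pos.2 (hε.strictAnti k.lt_succ_self)
  have h2 : 0 < epsShift ε k - ε k := sub_pos.2 (hε.epsShift_succ_lt k)
  rw [← inv_div, ← volume_preimage_affine (div_pos h2 h1)
    (-((epsShift ε k - ε k) / (ε k - ε (k + 1)) * ε (k + 1)) + ε k)]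
  refine measure_mono fun x hx => ?_
  have h := plMap_of_mem hε hx.1.1 hx.1.2
  rw [mul_sub, sub_eq_add_neg, add_assoc] at h
  rw [Set.mem_preimage, ← h]
  exact ⟨hε.plMap_mem_plPiece hx.1, hx.2⟩

theorem volume_plI₁_inter_le {ε : ℕ → ℝ} (hε : IsPLSequence ε) (E : Set ℝ) :
    volume (plI₁ ε ∩ plMap ε ⁻¹' E) ≤
      ENNReal.ofReal (1 - ε 0) * volume (Set.Ioc 0 1 ∩ E) := by
  have h1 : 0 < 1 - ε 0 := sub_pos.2 hε.zero_lt_one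
  conv_rhs => rw [← inv_inv (1 - ε 0)]
  rw [← volume_preimage_affine (inv_pos.2 h1) (-((1 - ε 0)⁻¹ * ε 0))]
  refine measure_mono fun x hx => ?_
  have h : plMap ε x = (1 - ε 0)⁻¹ * x + -((1 - ε 0)⁻¹ * ε 0) := by
    rw [plMap_of_lt hε hx.1.1, div_eq_inv_mul, mul_sub, sub_eq_add_neg]
  rw [Set.mem_preimage, ← h]
  exact ⟨hε.plMap_mem_Ioc hx.1, hx.2⟩

theorem measurable_plMap {ε : ℕ → ℝ} (hε : IsPLSequence ε) : Measurable (plMap ε) := by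
  intro E hE
  have hpre : plMap ε ⁻¹' E = (Set.Iic 0 ∩ (fun _ => (0 : ℝ)) ⁻¹' E) ∪
      (Set.Ioi (ε 0) ∩ (fun x => (x - ε 0) / (1 - ε 0)) ⁻¹' E) ∪
      ⋃ k, Set.Ioc (ε (k + 1)) (ε k) ∩ (fun x =>
        (epsShift ε k - ε k) / (ε k - ε (k + 1)) * (x - ε (k + 1)) + ε k) ⁻¹' E := by
    have h0 : ∀ x ≤ 0, plMap ε x = 0 := fun x hx => by simp [plMap, hx]
    ext x
    simp only [Set.mem_union, Set.mem_iUnion, Set.mem_inter_iff, Set.mem_preimage, Set.mem_Iic,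
      Set.mem_Ioi, Set.mem_Ioc]
    constructor
    · intro hx
      rcases le_or_gt x 0 with h | h
      · exact Or.inl (Or.inl ⟨h, h0 x h ▸ hx⟩)
      rcases lt_or_ge (ε 0) x with h' | h'
      · exact Or.inl (Or.inr ⟨h', plMap_of_lt hε h' ▸ hx⟩)
      obtain ⟨k, hk⟩ := hε.exists_mem_plPiece h (h'.trans hε.zero_lt_one.le)
      cases k with
      | zero => exact absurd hk.1 (not_lt.2 h')
      | succ k => exact Or.inr ⟨k, ⟨hk.1, hk.2⟩, plMap_of_mem hε hk.1 hk.2 ▸ hx⟩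
    · rintro ((⟨h, hx⟩ | ⟨h, hx⟩) | ⟨k, ⟨h1, h2⟩, hx⟩)
      · rwa [h0 x h]
      · rwa [plMap_of_lt hε h]
      · rwa [plMap_of_mem hε h1 h2]
  rw [hpre]
  refine ((measurableSet_Iic.inter (measurable_const hE)).union
    (measurableSet_Ioi.inter (Measurable.div_const (by fun_prop) _ hE))).union
    (MeasurableSet.iUnion fun k => measurableSet_Ioc.inter ?_)
  exact (show Measurable fun x =>
    (epsShift ε k - ε k) / (ε k - ε (k + 1)) * (x - ε (k + 1)) + ε k by fun_prop) hE

theorem measurableSet_plCylinder {ε : ℕ → ℝ} (hε : IsPLSequence ε) (w : List Bool) :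
    MeasurableSet (plCylinder ε w) := by
  classical
  induction w with
  | nil => simp [plCylinder, plWord, initialWord]
  | cons c w ih =>
    have h : plCylinder ε (c :: w) =
        {x | decide (x ∈ plI₁ ε) = c} ∩ plMap ε ⁻¹' plCylinder ε w := by
      ext x; exact mem_plCylinder_cons
    have hI : MeasurableSet (plI₁ ε) := measurableSet_Ioc
    rw [h]
    refine MeasurableSet.inter ?_ (hε.measurable_plMap ih)
    cases c with
    | true => simpa using hI
    | false => simp only [decide_eq_false_iff_not]; exact hI.compl

/-- A word with at least one `1` determines the piece in which the first passage happens. -/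
theorem exists_plCylinder_subset {ε : ℕ → ℝ} (hε : IsPLSequence ε) (w : List Bool)
    (hw : true ∈ w) : ∃ k, Set.Ioc 0 1 ∩ plCylinder ε w ⊆ plPiece ε k := by
  classical
  induction w with
  | nil => simp at hw
  | cons c w ih =>
    cases c with
    | true =>
      refine ⟨0, fun x hx => ?_⟩
      simpa [plPiece_zero] using (mem_plCylinder_cons.1 hx.2).1
    | false =>
      obtain ⟨k, hk⟩ := ih (by simpa using hw)
      refine ⟨k + 1, fun x ⟨hx, hxw⟩ => ?_⟩
      obtain ⟨j, hj⟩ := hε.exists_mem_plPiece hx.1 hx.2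
      obtain ⟨h1, h2⟩ := mem_plCylinder_cons.1 hxw
      cases j with
      | zero => exact absurd hj (by simpa [plPiece_zero] using h1)
      | succ j =>
        have hj' := hε.plMap_mem_plPiece hj
        have hle : plMap ε x ≤ 1 := hj'.2.trans (hε.epsShift_antitone (Nat.zero_le j))
        have hk' := hk ⟨⟨(hε.epsShift_pos _).trans hj'.1, hle⟩, h2⟩
        -- The image of `x` lies in the pieces `j` and `k`, and distinct pieces are disjoint.
        have h3 : ¬ j < k := fun h => absurd (hk'.2.trans
          (hε.epsShift_antitone (show j + 1 ≤ k by omega))) (not_le.2 hj'.1)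
        have h4 : ¬ k < j := fun h => absurd (hj'.2.trans
          (hε.epsShift_antitone (show k + 1 ≤ j by omega))) (not_le.2 hk'.1)
        have : j = k := by omega
        exact this ▸ hj

theorem ofReal_length_plPiece_le {ε : ℕ → ℝ} (hε : IsPLSequence ε) (k : ℕ) :
    ENNReal.ofReal (epsShift ε k - epsShift ε (k + 1)) ≤
      ENNReal.ofReal (max (1 - ε 0) (ε 0)) := by
  apply ENNReal.ofReal_le_ofReal
  cases k with
  | zero => exact le_max_left _ _
  | succ k =>
    refine le_max_of_le_right ?_
    have h1 := hε.epsShift_pos (k + 1 + 1)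
    have h2 : epsShift ε (k + 1) ≤ ε 0 := hε.epsShift_antitone (show 1 ≤ k + 1 by omega)
    linarith

/-- A word containing a one confines its points to a single piece, whose length at most `r` pays for
the first visit; a word without ones has the trivial bound 1. -/
theorem volume_Ioc_inter_plCylinder_le_of_plPiece {ε : ℕ → ℝ} (hε : IsPLSequence ε) {r : ℝ≥0∞}
    (hr0 : r ≠ 0) (hr1 : r ≤ 1)
    (hr : ∀ k, ENNReal.ofReal (epsShift ε k - epsShift ε (k + 1)) ≤ r) {w : List Bool}
    (h : ∀ k, r * volume (plPiece ε k ∩ plCylinder ε w) ≤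
      ENNReal.ofReal (epsShift ε k - epsShift ε (k + 1)) * r ^ w.count true) :
    volume (Set.Ioc 0 1 ∩ plCylinder ε w) ≤ r ^ w.count true := by
  by_cases hw : true ∈ w
  · obtain ⟨k, hk⟩ := hε.exists_plCylinder_subset w hw
    have h1 : r * volume (Set.Ioc 0 1 ∩ plCylinder ε w) ≤ r * r ^ w.count true :=
      calc _ ≤ r * volume (plPiece ε k ∩ plCylinder ε w) :=
            mul_le_mul_right (measure_mono (Set.subset_inter hk Set.inter_subset_right)) r
        _ ≤ _ := h k
        _ ≤ _ := mul_le_mul_left (hr k) _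
    exact (ENNReal.mul_le_mul_iff_right hr0 (ne_top_of_le_ne_top ENNReal.one_ne_top hr1)).1 h1
  · rw [List.count_eq_zero_of_not_mem hw, pow_zero]
    exact (measure_mono Set.inter_subset_left).trans (by simp)

/-- Relative to its piece, a cylinder with N ≥ 1 ones has measure at most r^(N-1): the first visit
is already decided by the piece and gains nothing. The factor `r` on the left avoids the exponent N
- 1. Affine branches preserve the relative measure until the orbit reaches I₁, which spreads over
all of (0, 1]. -/
theorem volume_plPiece_inter_plCylinder_le {ε : ℕ → ℝ} (hε : IsPLSequence ε) {r : ℝ≥0∞}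
    (hr0 : r ≠ 0) (hr1 : r ≤ 1)
    (hr : ∀ k, ENNReal.ofReal (epsShift ε k - epsShift ε (k + 1)) ≤ r) (w : List Bool) (k : ℕ) :
    r * volume (plPiece ε k ∩ plCylinder ε w) ≤
      ENNReal.ofReal (epsShift ε k - epsShift ε (k + 1)) * r ^ w.count true := by
  classical
  induction w generalizing k with
  | nil =>
    calc _ ≤ 1 * volume (plPiece ε k) := mul_le_mul' hr1 (measure_mono Set.inter_subset_left)
      _ = _ := by rw [volume_plPiece]; simp
  | cons c w ih =>
    have hsub : plCylinder ε (c :: w) ⊆ plMap ε ⁻¹' plCylinder ε w :=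
      fun x hx => (mem_plCylinder_cons.1 hx).2
    cases k with
    | zero =>
      -- The crude count suffices for both letters, although the cylinder misses I₁ when `c` is
      -- `false`.
      have hc : (c :: w).count true ≤ w.count true + 1 := by cases c <;> simp
      calc _ ≤ r * (ENNReal.ofReal (1 - ε 0) * volume (Set.Ioc 0 1 ∩ plCylinder ε w)) :=
            mul_le_mul_right ((measure_mono (Set.inter_subset_inter_right _ hsub)).trans
              (hε.volume_plI₁_inter_le _)) r
        _ ≤ r * (ENNReal.ofReal (1 - ε 0) * r ^ w.count true) := by
            gcongr
            exact hε.volume_Ioc_inter_plCylinder_le_of_plPiece hr0 hr1 hr ih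
        _ = ENNReal.ofReal (1 - ε 0) * r ^ (w.count true + 1) := by rw [pow_succ]; ring
        _ ≤ _ := mul_le_mul_right (pow_le_pow_right_of_le_one' hr1 hc) _
    | succ k =>
      cases c with
      | true =>
        have he : plPiece ε (k + 1) ∩ plCylinder ε (true :: w) = ∅ := by
          ext x
          simp only [Set.mem_inter_iff, Set.mem_empty_iff_false, iff_false, not_and]
          intro hx h
          exact hε.plPiece_succ_notMem hx (by simpa using (mem_plCylinder_cons.1 h).1)
        simp [he]
      | false =>
        have h2 : 0 < epsShift ε k - ε k := sub_pos.2 (hε.epsShift_succ_lt k)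
        have hmul : ENNReal.ofReal ((ε k - ε (k + 1)) / (epsShift ε k - ε k)) *
            ENNReal.ofReal (epsShift ε k - epsShift ε (k + 1)) =
            ENNReal.ofReal (epsShift ε (k + 1) - epsShift ε (k + 1 + 1)) := by
          rw [← ENNReal.ofReal_mul' (hε.epsShift_succ_lt k |> sub_pos.2).le]
          exact congrArg _ (div_mul_cancel₀ _ h2.ne')
        calc _ ≤ r * (ENNReal.ofReal ((ε k - ε (k + 1)) / (epsShift ε k - ε k)) *
              volume (plPiece ε k ∩ plCylinder ε w)) :=
              mul_le_mul_right ((measure_mono (Set.inter_subset_inter_right _ hsub)).trans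
                (hε.volume_plPiece_succ_inter_le k _)) r
          _ = ENNReal.ofReal ((ε k - ε (k + 1)) / (epsShift ε k - ε k)) *
              (r * volume (plPiece ε k ∩ plCylinder ε w)) := mul_left_comm _ _ _
          _ ≤ _ := mul_le_mul_right (ih k) _
          _ = _ := by rw [← mul_assoc, hmul]; simp

/-- A cylinder with `N` visits to `I₁` has Lebesgue measure at most `ρ ^ N`, where
`ρ = max (1 - ε_0) ε_0 < 1`. -/
theorem volume_Ioc_inter_plCylinder_le {ε : ℕ → ℝ} (hε : IsPLSequence ε) (w : List Bool) :
    volume (Set.Ioc 0 1 ∩ plCylinder ε w) ≤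
      ENNReal.ofReal (max (1 - ε 0) (ε 0)) ^ w.count true := by
  have hr0 : ENNReal.ofReal (max (1 - ε 0) (ε 0)) ≠ 0 :=
    (ENNReal.ofReal_pos.2 (lt_max_of_lt_right (hε.pos 0))).ne'
  have hr1 : ENNReal.ofReal (max (1 - ε 0) (ε 0)) ≤ 1 :=
    ENNReal.ofReal_le_one.2 (max_le (by linarith [hε.pos 0]) hε.zero_lt_one.le)
  exact hε.volume_Ioc_inter_plCylinder_le_of_plPiece hr0 hr1 hε.ofReal_length_plPiece_le
    (hε.volume_plPiece_inter_plCylinder_le hr0 hr1 hε.ofReal_length_plPiece_le w)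

end IsPLSequence

/-- This covers words without ones, for which the bound ρ^N is trivial. -/
theorem volume_Ioc_inter_plCylinder_cons_le (ε : ℕ → ℝ) (c : Bool) (w : List Bool) :
    volume (Set.Ioc 0 1 ∩ plCylinder ε (c :: w)) ≤ ENNReal.ofReal (max (1 - ε 0) (ε 0)) := by
  classical
  cases c with
  | true =>
    calc _ ≤ volume (Set.Ioc (ε 0) 1) := measure_mono fun x hx => by
            simpa [plI₁] using (mem_plCylinder_cons.1 hx.2).1
      _ ≤ _ := by
            rw [Real.volume_Ioc]
            exact ENNReal.ofReal_le_ofReal (le_max_left _ _)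
  | false =>
    calc _ ≤ volume (Set.Ioc 0 (ε 0)) := measure_mono fun x hx => ⟨hx.1.1, by
            have h : x ∉ plI₁ ε := by simpa using (mem_plCylinder_cons.1 hx.2).1
            exact not_lt.1 fun h' => h ⟨h', hx.1.2⟩⟩
      _ ≤ _ := by
            rw [Real.volume_Ioc, sub_zero]
            exact ENNReal.ofReal_le_ofReal (le_max_right _ _)

/-! ### Integrals of functions of the initial word -/

namespace IsPLSequence

theorem measurableSet_plWord_preimage {ε : ℕ → ℝ} (hε : IsPLSequence ε) (n : ℕ) (w : List Bool) :
    MeasurableSet (plWord ε n ⁻¹' {w}) := by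
  by_cases hw : w.length = n
  · subst hw
    exact hε.measurableSet_plCylinder w
  · convert MeasurableSet.empty
    ext x
    simp only [Set.mem_preimage, Set.mem_singleton_iff, Set.mem_empty_iff_false, iff_false]
    rintro rfl
    exact hw (length_plWord _ _ _)

theorem measurable_comp_plWord {ε : ℕ → ℝ} (hε : IsPLSequence ε) {β : Type*} [MeasurableSpace β]
    (n : ℕ) (g : List Bool → β) : Measurable fun x => g (plWord ε n x) := by
  let _ : MeasurableSpace (List Bool) := ⊤
  exact (measurable_from_top (f := g)).comp
    (measurable_to_countable' (hε.measurableSet_plWord_preimage n))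

/-- The sum runs over all words, so that it can be compared termwise with the Kraft sum; words of
length other than `n` have an empty preimage. -/
theorem lintegral_comp_plWord {ε : ℕ → ℝ} (hε : IsPLSequence ε) (n : ℕ) (φ : List Bool → ℝ≥0∞) :
    ∫⁻ x in Set.Ioc 0 1, φ (plWord ε n x) =
      ∑' w, φ w * volume (Set.Ioc 0 1 ∩ plWord ε n ⁻¹' {w}) := by
  let _ : MeasurableSpace (List Bool) := ⊤
  have hm : Measurable (plWord ε n) :=
    measurable_to_countable' (hε.measurableSet_plWord_preimage n)
  rw [← lintegral_map (f := φ) measurable_from_top hm, lintegral_countable']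
  refine tsum_congr fun w => ?_
  rw [Measure.map_apply hm (measurableSet_singleton w),
    Measure.restrict_apply (hε.measurableSet_plWord_preimage n w), Set.inter_comm]

theorem integrableOn_comp_plWord {ε : ℕ → ℝ} (hε : IsPLSequence ε) (n : ℕ) (g : List Bool → ℝ) :
    IntegrableOn (fun x => g (plWord ε n x)) (Set.Ioc 0 1) := by
  obtain ⟨B, hB⟩ := ((List.finite_length_eq Bool n).image fun w => ‖g w‖).bddAbove
  refine Integrable.of_bound (hε.measurable_comp_plWord n g).aestronglyMeasurable B
    (Eventually.of_forall fun x => hB ⟨_, length_plWord ε n x, rfl⟩)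

end IsPLSequence

theorem plWord_preimage_subset (ε : ℕ → ℝ) (n : ℕ) (w : List Bool) :
    plWord ε n ⁻¹' {w} ⊆ plCylinder ε w := by
  rintro x rfl
  simp [plCylinder, length_plWord]

/-- Dropping the null set {0} removes the fixed point that never enters I₁; every point of (0, 1]
lies in some piece. -/
theorem expectedVisits_eq (ε : ℕ → ℝ) (n : ℕ) :
    expectedVisits ε n = ∫ x in Set.Ioc (0 : ℝ) 1, ((plWord ε n x).count true : ℝ) := by
  simp only [expectedVisits, integral_Icc_eq_integral_Ioc, visits_eq_count, plWord]

theorem expectedAIC_eq (C : List Bool →. List Bool) (ε : ℕ → ℝ) (n : ℕ) :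
    expectedAIC C ε n = ∫ x in Set.Ioc (0 : ℝ) 1, (aic C (plWord ε n x) : ℝ) := by
  simp only [expectedAIC, integral_Icc_eq_integral_Ioc, plWord]

theorem expectedAIC_nonneg (C : List Bool →. List Bool) (ε : ℕ → ℝ) (n : ℕ) :
    0 ≤ expectedAIC C ε n :=
  integral_nonneg fun _ => Nat.cast_nonneg _

/-! ### The lower bound for the information content -/

/-- The visits are bounded by the information content, through a Kraft inequality and the
exponential decay of the measure of cylinders in the number of visits. -/
theorem expectedVisits_le_expectedAIC {C : List Bool →. List Bool} (hC : IsUniversalMachine C)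
    {ε : ℕ → ℝ} (hε : IsPLSequence ε) (n : ℕ) :
    -Real.log (max (1 - ε 0) (ε 0)) * expectedVisits ε n ≤
      Real.log 4 * expectedAIC C ε n + 2 := by
  have hρ : 0 < max (1 - ε 0) (ε 0) := lt_max_of_lt_right (hε.pos 0)
  set ρ := max (1 - ε 0) (ε 0) with hρdef
  -- The logarithm of `g` is the linear combination of visits and information content to be
  -- estimated, while the cylinder bound cancels its first factor.
  let g : List Bool → ℝ := fun w => (ρ ^ w.count true)⁻¹ * (4⁻¹ : ℝ) ^ aic C w
  have hg0 : ∀ w, 0 ≤ g w := fun w => by positivity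
  have hterm : ∀ w, ENNReal.ofReal (g w) * volume (Set.Ioc 0 1 ∩ plWord ε n ⁻¹' {w}) ≤
      (4⁻¹ : ℝ≥0∞) ^ aic C w := fun w =>
    calc _ ≤ ENNReal.ofReal (g w) * ENNReal.ofReal ρ ^ w.count true :=
          mul_le_mul_right ((measure_mono (Set.inter_subset_inter_right _
            (plWord_preimage_subset ε n w))).trans (hε.volume_Ioc_inter_plCylinder_le w)) _
      _ = ENNReal.ofReal ((4⁻¹ : ℝ) ^ aic C w) := by
          rw [← ENNReal.ofReal_pow hρ.le, ← ENNReal.ofReal_mul (hg0 w)]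
          congr 1
          simp only [g]
          field_simp
      _ = _ := by
          rw [ENNReal.ofReal_pow (by norm_num), ENNReal.ofReal_inv_of_pos (by norm_num)]
          norm_num
  have hlint : ∫⁻ x in Set.Ioc 0 1, ENNReal.ofReal (g (plWord ε n x)) ≤ 2 := by
    rw [hε.lintegral_comp_plWord n fun w => ENNReal.ofReal (g w)]
    exact (ENNReal.tsum_le_tsum hterm).trans hC.tsum_four_inv_pow_aic_le
  have hint : ∫ x in Set.Ioc (0 : ℝ) 1, g (plWord ε n x) ≤ 2 := by
    rw [← ofReal_integral_eq_lintegral_ofReal (hε.integrableOn_comp_plWord n g)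
      (Eventually.of_forall fun x => hg0 _)] at hlint
    have h2 : (2 : ℝ≥0∞) = ENNReal.ofReal 2 := by simp
    rw [h2] at hlint
    exact (ENNReal.ofReal_le_ofReal_iff (by norm_num)).1 hlint
  have hlog : ∀ w : List Bool,
      -Real.log ρ * (w.count true : ℝ) - Real.log 4 * (aic C w : ℝ) ≤ g w := fun w => by
    have hpos : 0 < g w := by simp only [g]; positivity
    have h : Real.log (g w) =
        -Real.log ρ * (w.count true : ℝ) - Real.log 4 * (aic C w : ℝ) := by
      simp only [g]
      rw [Real.log_mul (by positivity) (by positivity), Real.log_inv, Real.log_pow, Real.log_pow,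
        Real.log_inv]
      ring
    linarith [Real.log_le_sub_one_of_pos hpos]
  have hN := (hε.integrableOn_comp_plWord n fun w => (w.count true : ℝ)).const_mul (-Real.log ρ)
  have hA := (hε.integrableOn_comp_plWord n fun w => (aic C w : ℝ)).const_mul (Real.log 4)
  have h := integral_mono (hN.sub hA) (hε.integrableOn_comp_plWord n g) fun x => hlog (plWord ε n x)
  have h' := integral_sub hN hA
  rw [integral_const_mul, integral_const_mul, ← expectedVisits_eq, ← expectedAIC_eq] at h'
  simp only [Pi.sub_apply] at h
  linarith

/-- Only the output of the empty program can have information content zero, and for n ≥ 1 its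
cylinder has measure at most ρ. Off this cylinder the content is at least 1. -/
theorem one_sub_max_le_expectedAIC {C : List Bool →. List Bool} (hC : IsUniversalMachine C)
    {ε : ℕ → ℝ} (hε : IsPLSequence ε) {n : ℕ} (hn : n ≠ 0) :
    1 - max (1 - ε 0) (ε 0) ≤ expectedAIC C ε n := by
  classical
  obtain ⟨f, hf, hlen⟩ := hC.exists_injective_program
  have hρ : 0 < max (1 - ε 0) (ε 0) := lt_max_of_lt_right (hε.pos 0)
  set ρ := max (1 - ε 0) (ε 0) with hρdef
  -- At most one word has information content zero.
  obtain ⟨s, hs⟩ : ∃ s, ∀ w, aic C w = 0 → w = s := by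
    by_cases h : ∃ s, aic C s = 0
    · obtain ⟨s, hs⟩ := h
      refine ⟨s, fun w hw => hf ?_⟩
      rw [List.length_eq_zero_iff.1 ((hlen w).trans hw),
        List.length_eq_zero_iff.1 ((hlen s).trans hs)]
    · exact ⟨[], fun w hw => absurd ⟨w, hw⟩ h⟩
  have hmeas := hε.measurableSet_plWord_preimage n s
  have hvol : volume.real (Set.Ioc 0 1 ∩ plWord ε n ⁻¹' {s}) ≤ ρ := by
    refine ENNReal.toReal_le_of_le_ofReal hρ.le ?_
    cases s with
    | nil =>
      have h : plWord ε n ⁻¹' {[]} = ∅ := by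
        ext x
        simp only [Set.mem_preimage, Set.mem_singleton_iff, Set.mem_empty_iff_false, iff_false]
        intro h
        exact hn (by rw [← length_plWord ε n x, h]; rfl)
      simp [h]
    | cons c w =>
      exact (measure_mono (Set.inter_subset_inter_right _ (plWord_preimage_subset ε n _))).trans
        (volume_Ioc_inter_plCylinder_cons_le ε c w)
  have hle : ∀ w : List Bool, 1 - (if w = s then (1 : ℝ) else 0) ≤ aic C w := fun w => by
    split_ifs with h
    · simp
    · rw [sub_zero]
      exact_mod_cast Nat.one_le_iff_ne_zero.2 fun h0 => h (hs w h0)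
  have hi := hε.integrableOn_comp_plWord n fun w => if w = s then (1 : ℝ) else 0
  have hone : IntegrableOn (fun _ : ℝ => (1 : ℝ)) (Set.Ioc 0 1) := by simp
  have h := integral_mono (hone.sub hi) (hε.integrableOn_comp_plWord n fun w => (aic C w : ℝ))
    fun x => hle (plWord ε n x)
  have h' := integral_sub hone hi
  have hind : ∫ x in Set.Ioc (0 : ℝ) 1, (if plWord ε n x = s then (1 : ℝ) else 0) =
      volume.real (Set.Ioc 0 1 ∩ plWord ε n ⁻¹' {s}) := by
    have he : (fun x => if plWord ε n x = s then (1 : ℝ) else 0) =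
        (plWord ε n ⁻¹' {s}).indicator 1 := by
      ext x; simp [Set.indicator]
    rw [he, integral_indicator_one hmeas, measureReal_restrict_apply hmeas, Set.inter_comm]
  have hone' : ∫ _ in Set.Ioc (0 : ℝ) 1, (1 : ℝ) = 1 := by simp
  simp only [Pi.sub_apply] at h
  rw [← expectedAIC_eq] at h
  rw [hind, hone'] at h'
  linarith

/-! ### The upper bound for the information content -/

/-- Counting the visit at time 0 alone already gives the measure of I₁. -/
theorem one_sub_le_expectedVisits {ε : ℕ → ℝ} (hε : IsPLSequence ε) {n : ℕ} (hn : n ≠ 0) :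
    1 - ε 0 ≤ expectedVisits ε n := by
  classical
  obtain ⟨n, rfl⟩ := Nat.exists_eq_succ_of_ne_zero hn
  have hI : MeasurableSet (plI₁ ε) := measurableSet_Ioc
  have hsub : plI₁ ε ⊆ Set.Ioc 0 1 := Set.Ioc_subset_Ioc_left (hε.pos 0).le
  have hle : ∀ x, (plI₁ ε).indicator (1 : ℝ → ℝ) x ≤ ((plWord ε (n + 1) x).count true : ℝ) := by
    intro x
    by_cases hx : x ∈ plI₁ ε
    · simp [plWord_succ, hx]
    · simp [hx]
  have h := integral_mono (μ := volume.restrict (Set.Ioc 0 1)) (f := (plI₁ ε).indicator 1)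
    ((integrable_const (1 : ℝ)).indicator hI) (hε.integrableOn_comp_plWord (n + 1)
      fun w => (w.count true : ℝ)) hle
  rw [← expectedVisits_eq, integral_indicator_one hI, measureReal_restrict_apply hI,
    Set.inter_eq_left.2 hsub] at h
  simpa [plI₁, measureReal_def, hε.zero_lt_one.le] using h

theorem expectedAIC_le_expectedVisits {C : List Bool →. List Bool} (hC : IsUniversalMachine C)
    {ε : ℕ → ℝ} (hε : IsPLSequence ε) :
    ∃ c : ℝ, ∀ n : ℕ, expectedAIC C ε n ≤
      c + (expectedVisits ε n + 1) * (2 * (Nat.log 2 n + 1 : ℕ) + 2) := by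
  obtain ⟨c, hc⟩ := hC.exists_aic_le_gaps
  refine ⟨c, fun n => ?_⟩
  -- With this width n < 2^b, so every run length of a word of length `n` can be written.
  set b := Nat.log 2 n + 1
  have hle : ∀ x, (aic C (plWord ε n x) : ℝ) ≤
      c + (((plWord ε n x).count true : ℝ) + 1) * (2 * b + 2) := fun x => by
    exact_mod_cast hc b (plWord ε n x) (by
      rw [length_plWord]; exact Nat.lt_pow_succ_log_self one_lt_two n)
  have hconst : ∀ a : ℝ, IntegrableOn (fun _ : ℝ => a) (Set.Ioc 0 1) := fun a => by simp
  have hN := hε.integrableOn_comp_plWord n fun w => (w.count true : ℝ)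
  have hmul := (hN.add (hconst 1)).mul_const (2 * (b : ℝ) + 2)
  have h := integral_mono (hε.integrableOn_comp_plWord n fun w => (aic C w : ℝ))
    ((hconst c).add hmul) hle
  have h1 := integral_add (hconst c) hmul
  have h2 := integral_add hN (hconst 1)
  have hcint : ∀ a : ℝ, ∫ _ in Set.Ioc (0 : ℝ) 1, a = a := fun a => by simp
  simp only [Pi.add_apply] at h h1 h2
  rw [integral_mul_const, h2, hcint, hcint, ← expectedVisits_eq] at h1
  rw [← expectedAIC_eq] at h
  exact h.trans h1.le

/-! ### The asymptotic relations: absorbing the additive constants -/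

theorem expectedVisits_isBigO_expectedAIC {C : List Bool →. List Bool}
    (hC : IsUniversalMachine C) {ε : ℕ → ℝ} (hε : IsPLSequence ε) :
    expectedVisits ε =O[atTop] expectedAIC C ε := by
  have hρ : 0 < max (1 - ε 0) (ε 0) := lt_max_of_lt_right (hε.pos 0)
  have hρ1 : max (1 - ε 0) (ε 0) < 1 := max_lt (by linarith [hε.pos 0]) hε.zero_lt_one
  have hlower := fun n (hn : n ≠ 0) => one_sub_max_le_expectedAIC hC hε hn
  have hupper := expectedVisits_le_expectedAIC hC hε
  set ρ := max (1 - ε 0) (ε 0)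
  have hlog : 0 < -Real.log ρ := neg_pos.2 (Real.log_neg hρ hρ1)
  refine IsBigO.of_bound ((Real.log 4 + 2 / (1 - ρ)) / -Real.log ρ) ?_
  filter_upwards [eventually_ne_atTop 0] with n hn
  have hV : 0 ≤ expectedVisits ε n := integral_nonneg fun _ => Nat.cast_nonneg _
  rw [Real.norm_of_nonneg hV, Real.norm_of_nonneg (expectedAIC_nonneg C ε n), div_mul_eq_mul_div,
    le_div_iff₀ hlog]
  -- The lower bound 1 - ρ on the mean information content converts the additive 2 into a multiple
  -- of that mean.
  have h2 : 2 ≤ 2 / (1 - ρ) * expectedAIC C ε n := by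
    rw [div_mul_eq_mul_div, le_div_iff₀ (by linarith)]
    linarith [hlower n hn]
  linarith [hupper n]

theorem expectedAIC_isBigO_expectedVisits_mul_log {C : List Bool →. List Bool}
    (hC : IsUniversalMachine C) {ε : ℕ → ℝ} (hε : IsPLSequence ε) :
    expectedAIC C ε =O[atTop] fun n : ℕ => expectedVisits ε n * Real.log n := by
  obtain ⟨c, hc⟩ := expectedAIC_le_expectedVisits hC hε
  have hδ : 0 < 1 - ε 0 := sub_pos.2 hε.zero_lt_one
  have h1 : (fun _ : ℕ => (1 : ℝ)) =O[atTop] expectedVisits ε := by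
    refine IsBigO.of_bound (1 - ε 0)⁻¹ ?_
    filter_upwards [eventually_ne_atTop 0] with n hn
    have h := one_sub_le_expectedVisits hε hn
    rw [norm_one, Real.norm_of_nonneg (hδ.le.trans h), ← div_eq_inv_mul, le_div_iff₀ hδ]
    linarith
  have h2 : (fun _ : ℕ => (1 : ℝ)) =O[atTop] fun n : ℕ => Real.log n :=
    (Real.isLittleO_const_log_atTop.comp_tendsto tendsto_natCast_atTop_atTop).isBigO
  have h3 : (fun n : ℕ => (2 * (Nat.log 2 n + 1 : ℕ) + 2 : ℝ)) =O[atTop]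
      fun n : ℕ => Real.log n := by
    have h : (fun n : ℕ => (Nat.log 2 n : ℝ)) =O[atTop] fun n : ℕ => Real.log n := by
      refine IsBigO.of_bound (Real.log 2)⁻¹ (Eventually.of_forall fun n => ?_)
      have := Real.natLog_le_logb n 2
      rw [Real.logb] at this
      rw [Real.norm_of_nonneg (Nat.cast_nonneg _), Real.norm_of_nonneg (Real.log_natCast_nonneg n),
        ← div_eq_inv_mul]
      exact_mod_cast this
    refine ((h.const_mul_left 2).add (h2.const_mul_left 4)).congr_left fun n => ?_
    push_cast
    ring
  have h4 : (fun n => c + (expectedVisits ε n + 1) * (2 * (Nat.log 2 n + 1 : ℕ) + 2)) =O[atTop]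
      fun n : ℕ => expectedVisits ε n * Real.log n := by
    -- Both additive constants disappear because 1 is O(E[N_n]) and O(log n).
    refine IsBigO.add ?_ (((isBigO_refl _ _).add h1).mul h3)
    simpa using (h1.mul h2).const_mul_left c
  refine IsBigO.trans (IsBigO.of_bound 1 (Eventually.of_forall fun n => ?_)) h4
  rw [one_mul, Real.norm_of_nonneg (expectedAIC_nonneg C ε n)]
  exact (hc n).trans (le_abs_self _)

theorem mainTheorem6 (C : List Bool →. List Bool) (hC : IsUniversalMachine C)
    (ε : ℕ → ℝ) (hε : IsPLSequence ε) (A α : ℝ) (hα : 0 < α)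
    (hF : (fun x : ℝ => plDistr ε x - (1 - A * x ^ (-α))) =o[atTop] fun x : ℝ => x ^ (-α)) :
    (expectedVisits ε =O[atTop] expectedAIC C ε) ∧
      (expectedAIC C ε =O[atTop] fun n : ℕ => expectedVisits ε n * Real.log n) :=
  ⟨expectedVisits_isBigO_expectedAIC hC hε, expectedAIC_isBigO_expectedVisits_mul_log hC hε⟩
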